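/- Consider the discrete-time LTI system $x(t+1)=Ax(t)+Bu(t)$, $x(0)=x_0$, with measured output $\tilde y(t)=Cx(t)+Du(t)+v(t)$, where $x(t)\in\mathbb R^n$, $u(t)\in\mathbb R^m$, and the measurement noise satisfies $v(t)\in\mathbb V\subseteq\mathbb R^p$. Let $(A,B)$ be controllable and $(A,C)$ detectable, let $P\in\mathbb R^{n\times n}$, $R\in\mathbb R^{p\times p}$ be symmetric positive definite, $\rho\in(0,1)$, and let $\mathbb X\subseteq\mathbb R^n$ be a state constraint set. Write $|\cdot|$ for the Euclidean norm, $|x|_P=\sqrt{x^\top Px}$, and $H_h(w_{[0,M-1]})$ for the Hankel matrix of depth $h$ of $w(0),\dots,w(M-1)$, whose $(i,j)$ block is $w(i+j)$ for $0\le i\le h-1$, $0\le j\le M-h$. A sequence $u(0),\dots,u(N-1)$ in $\mathbb R^m$ is persistently exciting of order $K$ if $\operatorname{rank}H_K(u_{[0,N-1]})=mK$. Call $p_0,r_0\ge1$, $\eta\in(0,1)$ e-UOSS constants of the system if for all $x_1,x_2\in\mathbb R^n$, every input sequence $u$ and all $t\ge0$, the noise-free state trajectories $x^{(1)},x^{(2)}$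 from $x_1,x_2$ under $u$ and their noise-free outputs $y^{(1)},y^{(2)}$ satisfy $$|x^{(1)}(t)-x^{(2)}(t)|\le p_0|x_1-x_2|\eta^t+\sum_{\tau=1}^t r_0|y^{(1)}(t-\tau)-y^{(2)}(t-\tau)|\eta^\tau .$$ Such constants exist because $(A,C)$ is detectable. Let $p_0,r_0,\eta$ be e-UOSS constants with $\eta\le\rho$, $p_0\le\lambda_{\min}(P)$ and $r_0\le\lambda_{\min}(R)$. Data-driven MHE with horizon $L\ge1$: let $u^d(k),x^d(k),y^d(k)$, $0\le k\le N-1$, be a noise-free (offline) input/state/output trajectory of the system. Starting from an initial estimate $\hat x(0)\in\mathbb R^n$, at each time $t\ge1$ put $h=L$ if $t\ge L$ and $h=t$ if $t<L$ (full information estimation), and minimize $$|\bar x(t-h|t)-\hat x(t-h)|_P^2\,\rho^h+\sum_{k=1}^h|\sigma^y(t-k|t)|_R^2\,\rho^k$$ over $\bar x(t-h|t),\dots,\bar x(t|t)\in\mathbb X$, $\sigma^y(t-h|t),\dots,\sigma^y(t-1|t)\in\mathbb R^p$ and $\alpha\in\mathbb R^{N-h}$ subject to $$\begin{bmatrix}H_h(u^d_{[0,N-2]})\\H_h(y^d_{[0,N-2]})\\H_{h+1}(x^d_{[0,N-1]})\end{bmatrix}\alpha=\begin{bmatrix}u_{[t-h,t-1]}\\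 \tilde y_{[t-h,t-1]}-\sigma^y_{[-h,-1]}(t)\\ \bar x_{[-h,0]}(t)\end{bmatrix},$$ where $w_{[a,b]}$ stacks $w(a),\dots,w(b)$, and $\sigma^y_{[-h,-1]}(t)$ and $\bar x_{[-h,0]}(t)$ stack the $\sigma^y(t-k|t)$ and the $\bar x(t-k|t)$ in increasing order of time. The estimate $\hat x(t)$ is the component $\bar x(t|t)$ of an optimizer. Then there exists $L_{\min}$ such that for all $L\ge L_{\min}$, $L\geq 1$, and all noise-free offline trajectories whose input $u^d(0),\dots,u^d(N-1)$ is persistently exciting of order $L+n+1$, the MHE is robustly globally exponentially stable: there exist $c_1,c_2\ge1$ and $\lambda_1,\lambda_2\in(0,1)$ such that for all $x_0,\hat x(0)\in\mathbb R^n$, all input sequences $u$ and all noise sequences $v$ in $\mathbb V$ for which the true state satisfies $x(t)\in\mathbb X$ for all $t\ge0$, every resulting sequence of estimates satisfies $$|x(t)-\hat x(t)|\le c_1|x_0-\hat x(0)|\lambda_1^t+\sum_{\tau=1}^t c_2|v(t-\tau)|\lambda_2^\tau\qquad\text{for all }t\ge0 .$$ Moreover, if $\mathbb X$ is closed, then such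 a sequence of estimates exists for all these $x_0,\hat x(0),u$ and all noise sequences $v$. -/

import Mathlib

open scoped Matrix

noncomputable section

namespace DataMHE

/-- The Euclidean norm `|x|` of a real vector. -/
def vnorm {d : ℕ} (x : Fin d → ℝ) : ℝ := ‖WithLp.toLp 2 x‖

/-- The weighted norm `|x|_P = √(xᵀ P x)`. -/
def wnorm {d : ℕ} (P : Matrix (Fin d) (Fin d) ℝ) (x : Fin d → ℝ) : ℝ :=
  Real.sqrt (x ⬝ᵥ (P *ᵥ x))

/-- The minimal eigenvalue of a symmetric real matrix. -/
def lambdaMin {d : ℕ} (P : Matrix (Fin d) (Fin d) ℝ) : ℝ := sInf (spectrum ℝ P)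

/-- The state `x(t; x₀, u)` of `x(t+1) = A x(t) + B u(t)`, `x(0) = x₀`. -/
def stateTraj {n m : ℕ} (A : Matrix (Fin n) (Fin n) ℝ) (B : Matrix (Fin n) (Fin m) ℝ)
    (x₀ : Fin n → ℝ) (u : ℕ → Fin m → ℝ) : ℕ → Fin n → ℝ
  | 0 => x₀
  | t + 1 => A *ᵥ stateTraj A B x₀ u t + B *ᵥ u t

/-- The noise-free output `h(x, u) = C x + D u`. -/
def outputMap {n m p : ℕ} (C : Matrix (Fin p) (Fin n) ℝ) (D : Matrix (Fin p) (Fin m) ℝ)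
    (x : Fin n → ℝ) (u : Fin m → ℝ) : Fin p → ℝ :=
  C *ᵥ x + D *ᵥ u

/-- The online measured output `ỹ(t) = C x(t) + D u(t) + v(t)`. -/
def noisyOutput {n m p : ℕ} (A : Matrix (Fin n) (Fin n) ℝ) (B : Matrix (Fin n) (Fin m) ℝ)
    (C : Matrix (Fin p) (Fin n) ℝ) (D : Matrix (Fin p) (Fin m) ℝ)
    (x₀ : Fin n → ℝ) (u : ℕ → Fin m → ℝ) (v : ℕ → Fin p → ℝ) : ℕ → Fin p → ℝ :=
  fun t => outputMap C D (stateTraj A B x₀ u t) (u t) + v t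

/-- The controllability matrix `[B, AB, …, A^{n-1}B]`. -/
def ctrbMatrix {n m : ℕ} (A : Matrix (Fin n) (Fin n) ℝ) (B : Matrix (Fin n) (Fin m) ℝ) :
    Matrix (Fin n) (Fin n × Fin m) ℝ :=
  Matrix.of fun i q => (A ^ (q.1 : ℕ) * B) i q.2

/-- `(A, B)` is controllable. -/
def Controllable {n m : ℕ} (A : Matrix (Fin n) (Fin n) ℝ)
    (B : Matrix (Fin n) (Fin m) ℝ) : Prop :=
  (ctrbMatrix A B).rank = n

/-- All complex eigenvalues of `M` lie in the open unit disc. -/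
def SchurStable {n : ℕ} (M : Matrix (Fin n) (Fin n) ℝ) : Prop :=
  ∀ μ ∈ spectrum ℂ (M.map (algebraMap ℝ ℂ)), ‖μ‖ < 1

/-- `(A, C)` is detectable: some output injection makes `A + K C` Schur stable. -/
def Detectable {n p : ℕ} (A : Matrix (Fin n) (Fin n) ℝ)
    (C : Matrix (Fin p) (Fin n) ℝ) : Prop :=
  ∃ K : Matrix (Fin n) (Fin p) ℝ, SchurStable (A + K * C)

/-- The system is incrementally exponentially uniformly output-to-state stable (e-UOSS)
with the constants `p₀, r₀ ≥ 1` and `η ∈ (0, 1)`. -/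
def IsEUOSS {n m p : ℕ} (A : Matrix (Fin n) (Fin n) ℝ) (B : Matrix (Fin n) (Fin m) ℝ)
    (C : Matrix (Fin p) (Fin n) ℝ) (D : Matrix (Fin p) (Fin m) ℝ) (p₀ r₀ η : ℝ) : Prop :=
  1 ≤ p₀ ∧ 1 ≤ r₀ ∧ 0 < η ∧ η < 1 ∧
    ∀ (x₁ x₂ : Fin n → ℝ) (u : ℕ → Fin m → ℝ) (t : ℕ),
      vnorm (stateTraj A B x₁ u t - stateTraj A B x₂ u t) ≤
        p₀ * vnorm (x₁ - x₂) * η ^ t +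
          ∑ τ ∈ Finset.Icc 1 t,
            r₀ * vnorm (outputMap C D (stateTraj A B x₁ u (t - τ)) (u (t - τ)) -
              outputMap C D (stateTraj A B x₂ u (t - τ)) (u (t - τ))) * η ^ τ

/-- The Hankel matrix with `depth` block rows and `cols` columns whose `(i, j)` block is
`w (i + j)`. It is the Hankel matrix of the given depth of a window `w(0), …, w(N-1)` of
length `N` when `cols = N - depth + 1`. -/
def hankel {d : ℕ} (depth cols : ℕ) (w : ℕ → Fin d → ℝ) :
    Matrix (Fin depth × Fin d) (Fin cols) ℝ :=
  Matrix.of fun q j => w ((q.1 : ℕ) + (j : ℕ)) q.2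

/-- `u(0), …, u(N-1)` is persistently exciting of order `K`: its Hankel matrix of depth `K`
has full row rank. -/
def PersistentlyExciting {m : ℕ} (N K : ℕ) (u : ℕ → Fin m → ℝ) : Prop :=
  (hankel K (N + 1 - K) u).rank = m * K

/-- `(u(k), x(k), y(k))`, `k = 0, …, N-1`, is a noise-free input/state/output trajectory
of the system. -/
def IsOfflineTrajectory {n m p : ℕ} (A : Matrix (Fin n) (Fin n) ℝ)
    (B : Matrix (Fin n) (Fin m) ℝ) (C : Matrix (Fin p) (Fin n) ℝ)
    (D : Matrix (Fin p) (Fin m) ℝ) (N : ℕ)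
    (u : ℕ → Fin m → ℝ) (x : ℕ → Fin n → ℝ) (y : ℕ → Fin p → ℝ) : Prop :=
  (∀ k, k + 1 < N → x (k + 1) = A *ᵥ x k + B *ᵥ u k) ∧
    ∀ k, k < N → y k = C *ᵥ x k + D *ᵥ u k

/-- The ingredients of the estimator: `N` offline samples of input, state and output, the
weights `P`, `R`, the discount factor `ρ` and the state constraint set `X`. -/
structure Scheme (n m p : ℕ) where
  N : ℕ
  ud : ℕ → Fin m → ℝ
  xd : ℕ → Fin n → ℝ
  yd : ℕ → Fin p → ℝ
  P : Matrix (Fin n) (Fin n) ℝ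
  R : Matrix (Fin p) (Fin p) ℝ
  ρ : ℝ
  X : Set (Fin n → ℝ)

/-- The decision variables of the problem with horizon `h` at time `t`:
`xbar j = x̄(t-h+j|t)` for `j = 0, …, h`, `sigma j = σ^y(t-h+j|t)` for `j = 0, …, h-1`, and
`α`, whose length `N - h` is the number of columns of the Hankel matrices of depth `h` of
`u^d_{[0,N-2]}`, `y^d_{[0,N-2]}` and of depth `h + 1` of `x^d_{[0,N-1]}`. -/
structure Decision (n p N h : ℕ) where
  xbar : Fin (h + 1) → Fin n → ℝ
  alpha : Fin (N - h) → ℝ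
  sigma : Fin h → Fin p → ℝ

/-- The constraints of the problem with horizon `h` at time `t`, given the online inputs `u`
and the online measured outputs `y`. -/
def Scheme.Feasible {n m p : ℕ} (S : Scheme n m p) (h t : ℕ) (u : ℕ → Fin m → ℝ)
    (y : ℕ → Fin p → ℝ) (z : Decision n p S.N h) : Prop :=
  (hankel h (S.N - h) S.ud *ᵥ z.alpha = fun q => u (t - h + (q.1 : ℕ)) q.2) ∧
  (hankel h (S.N - h) S.yd *ᵥ z.alpha =
    fun q => y (t - h + (q.1 : ℕ)) q.2 - z.sigma q.1 q.2) ∧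
  (hankel (h + 1) (S.N - h) S.xd *ᵥ z.alpha = fun q => z.xbar q.1 q.2) ∧
  ∀ j, z.xbar j ∈ S.X

/-- The cost `|x̄(t-h|t) - prior|_P² ρ^h + ∑_{k=1}^h |σ^y(t-k|t)|_R² ρ^k`; the summand of
index `j` is the one with `k = h - j`. -/
def Scheme.cost {n m p : ℕ} (S : Scheme n m p) (h : ℕ) (prior : Fin n → ℝ)
    (z : Decision n p S.N h) : ℝ :=
  wnorm S.P (z.xbar 0 - prior) ^ 2 * S.ρ ^ h +
    ∑ j : Fin h, wnorm S.R (z.sigma j) ^ 2 * S.ρ ^ (h - (j : ℕ))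

/-- `z` is an optimizer of the problem with horizon `h` at time `t`. -/
def Scheme.IsOptimal {n m p : ℕ} (S : Scheme n m p) (h t : ℕ) (u : ℕ → Fin m → ℝ)
    (y : ℕ → Fin p → ℝ) (prior : Fin n → ℝ) (z : Decision n p S.N h) : Prop :=
  S.Feasible h t u y z ∧
    ∀ z' : Decision n p S.N h, S.Feasible h t u y z' → S.cost h prior z ≤ S.cost h prior z'

/-- `xhat` is a sequence of estimates produced by the moving horizon estimator of horizon `L`
from the initial estimate `xhat₀`, the online inputs `u` and the online measured outputs `y`:
`xhat 0 = xhat₀`; for `0 < t < L` the estimate is the last state of an optimizer of the full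
information problem (horizon `t`, prior `xhat 0`); for `t ≥ L` it is the last state of an
optimizer of the problem with horizon `L` and prior `xhat (t - L)`. -/
def Scheme.IsEstimate {n m p : ℕ} (S : Scheme n m p) (L : ℕ) (xhat₀ : Fin n → ℝ)
    (u : ℕ → Fin m → ℝ) (y : ℕ → Fin p → ℝ) (xhat : ℕ → Fin n → ℝ) : Prop :=
  xhat 0 = xhat₀ ∧
  (∀ t, 0 < t → t < L → ∃ z : Decision n p S.N t,
    S.IsOptimal t t u y (xhat 0) z ∧ xhat t = z.xbar (Fin.last t)) ∧
  (∀ t, 0 < t → L ≤ t → ∃ z : Decision n p S.N L,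
    S.IsOptimal L t u y (xhat (t - L)) z ∧ xhat t = z.xbar (Fin.last L))

/-- Robust global exponential stability of a (possibly set-valued) state estimator: `Est`
relates an initial estimate, an input sequence and a measured output sequence to the sequences
of estimates. The noise takes values in `V` and the true states satisfy the state constraint. -/
def IsRGES {n m p : ℕ} (A : Matrix (Fin n) (Fin n) ℝ) (B : Matrix (Fin n) (Fin m) ℝ)
    (C : Matrix (Fin p) (Fin n) ℝ) (D : Matrix (Fin p) (Fin m) ℝ)
    (X : Set (Fin n → ℝ)) (V : Set (Fin p → ℝ))
    (Est : (Fin n → ℝ) → (ℕ → Fin m → ℝ) → (ℕ → Fin p → ℝ) → (ℕ → Fin n → ℝ) → Prop) : Prop :=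
  ∃ c₁ c₂ lam₁ lam₂ : ℝ, 1 ≤ c₁ ∧ 1 ≤ c₂ ∧ lam₁ ∈ Set.Ioo (0 : ℝ) 1 ∧
    lam₂ ∈ Set.Ioo (0 : ℝ) 1 ∧
    ∀ (x₀ xhat₀ : Fin n → ℝ) (u : ℕ → Fin m → ℝ) (v : ℕ → Fin p → ℝ),
      (∀ t, v t ∈ V) → (∀ t, stateTraj A B x₀ u t ∈ X) →
      ∀ xhat : ℕ → Fin n → ℝ, Est xhat₀ u (noisyOutput A B C D x₀ u v) xhat →
        ∀ t : ℕ, vnorm (stateTraj A B x₀ u t - xhat t) ≤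
          c₁ * vnorm (x₀ - xhat₀) * lam₁ ^ t +
            ∑ τ ∈ Finset.Icc 1 t, c₂ * vnorm (v (t - τ)) * lam₂ ^ τ

end DataMHE

end

/-!
The proof separates the data from the estimation.

*Data.* By Willems' fundamental lemma, here `IsOfflineTrajectory.exists_alpha` together with
`IsOfflineTrajectory.combination`, the column space of the Hankel matrices consists of exactly the
system trajectories of the respective length. The core of the former is a trivial left kernel
(`IsOfflineTrajectory.left_kernel_trivial`), where the Cayley-Hamilton theorem eliminates the
state. Hence a decision variable is feasible iff its states and fitted noise form an admissible
trajectory, and the problem becomes a minimization over the first state of the window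
(`Scheme.Feasible.cost_eq`). The cost is continuous and coercive there, so that minimizers exist
over closed constraint sets (`Scheme.exists_isOptimal`).

*Stability.* The true trajectory is feasible, with the true noise as fitted noise, so its cost
bounds the optimal one. The output-to-state estimate applied to the true and the estimated
trajectory bounds the current error by the error at the start of the window and the difference of
the true and the fitted noise. Since `p₀ ≤ lambdaMin P`, `r₀ ≤ lambdaMin R` and `η ≤ ρ`, the
contribution of the estimate is controlled by the optimal cost, through the Cauchy-Schwarz
inequality and a geometric series (`window_error_le`). With `μ = √ρ` and `h` the length of the
window this gives
`|e(t)| ≤ c |e(t-h)| μ ^ h + ∑ c |v(t-τ)| μ ^ τ`, where `c` depends neither on the data nor on the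
horizon (`exists_window_error_le`). Once `c √μ ^ L ≤ 1`, each full window contracts by `√μ ^ L`
without accumulating constants, and induction over the windows gives the rate `√μ`
(`error_le_of_window_error_le`).

The existence of output-to-state constants for detectable systems follows from an output injection
and Gelfand's formula (`Detectable.exists_isEUOSS`).
-/

namespace DataMHE

/-! ### The Euclidean norm and quadratic forms -/

section Norms

lemma vnorm_nonneg {d : ℕ} (x : Fin d → ℝ) : 0 ≤ vnorm x := norm_nonneg _

lemma vnorm_sub_le {d : ℕ} (x y : Fin d → ℝ) : vnorm (x - y) ≤ vnorm x + vnorm y := by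
  simpa [vnorm] using norm_sub_le (WithLp.toLp 2 x) (WithLp.toLp 2 y)

lemma vnorm_sum_le {d : ℕ} {ι : Type*} (s : Finset ι) (f : ι → Fin d → ℝ) :
    vnorm (∑ i ∈ s, f i) ≤ ∑ i ∈ s, vnorm (f i) := by
  simpa [vnorm, WithLp.toLp_sum] using norm_sum_le s fun i => WithLp.toLp 2 (f i)

lemma vnorm_sq {d : ℕ} (x : Fin d → ℝ) : vnorm x ^ 2 = x ⬝ᵥ x := by
  rw [vnorm, EuclideanSpace.norm_sq_eq]
  simp [dotProduct, pow_two]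

lemma norm_le_vnorm {d : ℕ} (x : Fin d → ℝ) : ‖x‖ ≤ vnorm x := by
  rw [pi_norm_le_iff_of_nonneg (vnorm_nonneg x)]
  exact fun i => PiLp.norm_apply_le (WithLp.toLp 2 x) i

open scoped Matrix.Norms.L2Operator in
lemma exists_vnorm_mulVec_le {a b : ℕ} (M : Matrix (Fin a) (Fin b) ℝ) :
    ∃ K : ℝ, 0 ≤ K ∧ ∀ x, vnorm (M *ᵥ x) ≤ K * vnorm x :=
  ⟨‖M‖, norm_nonneg _, fun x => Matrix.l2_opNorm_mulVec M (WithLp.toLp 2 x)⟩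

lemma exists_dotProduct_mulVec_le {d : ℕ} (P : Matrix (Fin d) (Fin d) ℝ) :
    ∃ K : ℝ, 0 ≤ K ∧ ∀ x, x ⬝ᵥ (P *ᵥ x) ≤ K * vnorm x ^ 2 := by
  obtain ⟨K, hK, h⟩ := exists_vnorm_mulVec_le P
  refine ⟨K, hK, fun x => ?_⟩
  have h1 : x ⬝ᵥ (P *ᵥ x) ≤ vnorm x * vnorm (P *ᵥ x) := by
    have := real_inner_le_norm (WithLp.toLp 2 x) (WithLp.toLp 2 (P *ᵥ x))
    rwa [EuclideanSpace.inner_toLp_toLp, star_trivial, dotProduct_comm] at this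
  calc _ ≤ vnorm x * vnorm (P *ᵥ x) := h1
    _ ≤ vnorm x * (K * vnorm x) := by gcongr; exacts [vnorm_nonneg x, h x]
    _ = _ := by ring

open scoped Pointwise in
/-- The Rayleigh bound: subtracting `lambdaMin P` shifts the spectrum into `[0, ∞)`. -/
lemma lambdaMin_mul_sq_le {d : ℕ} {P : Matrix (Fin d) (Fin d) ℝ} (hP : P.PosDef)
    (x : Fin d → ℝ) : lambdaMin P * vnorm x ^ 2 ≤ x ⬝ᵥ (P *ᵥ x) := by
  set Q := P - algebraMap ℝ _ (lambdaMin P) with hQ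
  have hQh : Q.IsHermitian := by
    refine hP.isHermitian.sub ?_
    rw [Matrix.algebraMap_eq_diagonal]
    exact Matrix.isHermitian_diagonal _
  have hQp : Q.PosSemidef := by
    rw [hQh.posSemidef_iff_eigenvalues_nonneg]
    intro i
    have h1 : hQh.eigenvalues i ∈ spectrum ℝ P - ({lambdaMin P} : Set ℝ) := by
      rw [spectrum.sub_singleton_eq P (lambdaMin P)]
      exact hQh.eigenvalues_mem_spectrum_real i
    obtain ⟨a, ha, b, hb, hab⟩ := h1
    have h2 : lambdaMin P ≤ a := csInf_le P.finite_real_spectrum.bddBelow ha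
    simp only [Set.mem_singleton_iff] at hb
    subst hb
    simp only at hab
    simp only [Pi.zero_apply]
    rw [← hab]
    linarith
  have h := hQp.dotProduct_mulVec_nonneg x
  rw [hQ, Matrix.sub_mulVec, dotProduct_sub, Algebra.algebraMap_eq_smul_one, Matrix.smul_mulVec,
    Matrix.one_mulVec, dotProduct_smul, star_trivial, ← vnorm_sq, smul_eq_mul] at h
  linarith

lemma wnorm_sq {d : ℕ} {P : Matrix (Fin d) (Fin d) ℝ} (hP : P.PosDef) (x : Fin d → ℝ) :
    wnorm P x ^ 2 = x ⬝ᵥ (P *ᵥ x) :=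
  Real.sq_sqrt (by simpa using hP.posSemidef.dotProduct_mulVec_nonneg x)

lemma continuous_wnorm {d : ℕ} (P : Matrix (Fin d) (Fin d) ℝ) : Continuous (wnorm P) := by
  unfold wnorm
  fun_prop

end Norms

/-! ### Detectable systems are output-to-state stable -/

section Detectability

open scoped Matrix.Norms.L2Operator in
/-- By Gelfand's formula, the powers of a Schur stable matrix decay exponentially. -/
lemma SchurStable.exists_vnorm_pow_mulVec_le {n : ℕ} {F : Matrix (Fin n) (Fin n) ℝ}
    (hF : SchurStable F) :
    ∃ c η : ℝ, 0 < c ∧ 0 < η ∧ η < 1 ∧ ∀ (t : ℕ) (x : Fin n → ℝ),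
      vnorm ((F ^ t) *ᵥ x) ≤ c * η ^ t * vnorm x := by
  obtain hn | hn := isEmpty_or_nonempty (Fin n)
  · refine ⟨1, 1 / 2, by norm_num, by norm_num, by norm_num, fun t x => ?_⟩
    have h0 : x = 0 := Subsingleton.elim _ _
    simp [h0, vnorm]
  set G : Matrix (Fin n) (Fin n) ℂ := F.map (algebraMap ℝ ℂ) with hG
  have hr : spectralRadius ℂ G < ((1 : NNReal) : ENNReal) :=
    spectrum.spectralRadius_lt_of_forall_lt G fun μ hμ => by
      simpa [← NNReal.coe_lt_coe] using hF μ hμ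
  obtain ⟨η, hη, hη1⟩ := ENNReal.lt_iff_exists_nnreal_btwn.1 hr
  have hη1' : η < 1 := by exact_mod_cast hη1
  have hη0 : 0 < η := by
    rcases eq_or_ne η 0 with h | h
    · simp [h] at hη
    · exact pos_iff_ne_zero.2 h
  have hev := (spectrum.pow_nnnorm_pow_one_div_tendsto_nhds_spectralRadius G).eventually
    (gt_mem_nhds hη)
  have hO : (fun t : ℕ => G ^ t) =O[Filter.atTop] fun t : ℕ => (η : ℝ) ^ t := by
    refine Asymptotics.IsBigO.of_bound 1 ?_
    filter_upwards [hev, Filter.eventually_gt_atTop 0] with t ht ht0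
    have h1 : ((‖G ^ t‖₊ : NNReal) : ENNReal) ≤ ((η ^ t : NNReal) : ENNReal) := by
      have := ENNReal.rpow_le_rpow ht.le (Nat.cast_nonneg t : (0 : ℝ) ≤ (t : ℝ))
      rwa [← ENNReal.rpow_mul, one_div_mul_cancel (by positivity), ENNReal.rpow_one,
        ENNReal.rpow_natCast, ← ENNReal.coe_pow] at this
    have h2 : ‖G ^ t‖₊ ≤ η ^ t := by exact_mod_cast h1
    have h3 : ‖G ^ t‖ ≤ (η : ℝ) ^ t := by exact_mod_cast h2
    simpa using h3
  obtain ⟨c, hc, hb⟩ := Asymptotics.bound_of_isBigO_nat_atTop hO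
  refine ⟨c, η, hc, by exact_mod_cast hη0, by exact_mod_cast hη1', fun t x => ?_⟩
  -- the Euclidean norm of a real vector is that of its complexification
  have hnorm : ∀ z : Fin n → ℝ,
      vnorm z = ‖(WithLp.toLp 2 (fun i => (z i : ℂ)) : EuclideanSpace ℂ (Fin n))‖ := fun z => by
    simp [vnorm, EuclideanSpace.norm_eq]
  have hmap : (fun i => (((F ^ t) *ᵥ x) i : ℂ)) = (G ^ t) *ᵥ fun i => (x i : ℂ) := by
    ext i
    rw [hG, ← Matrix.map_pow]
    simp [Matrix.mulVec, dotProduct]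
  have h4 : ‖G ^ t‖ ≤ c * (η : ℝ) ^ t := by
    have hne : (η : ℝ) ^ t ≠ 0 := pow_ne_zero _ (by exact_mod_cast hη0.ne')
    simpa using hb hne
  rw [hnorm, hnorm, hmap]
  exact (Matrix.l2_opNorm_mulVec (G ^ t) (WithLp.toLp 2 _)).trans
    (mul_le_mul_of_nonneg_right h4 (norm_nonneg _))

/-- With `A + K C` in place of `A`, the state difference is driven by the output difference
only. -/
lemma stateTraj_sub_eq {n m p : ℕ} (A : Matrix (Fin n) (Fin n) ℝ) (B : Matrix (Fin n) (Fin m) ℝ)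
    (C : Matrix (Fin p) (Fin n) ℝ) (D : Matrix (Fin p) (Fin m) ℝ) (K : Matrix (Fin n) (Fin p) ℝ)
    (x₁ x₂ : Fin n → ℝ) (u : ℕ → Fin m → ℝ) (t : ℕ) :
    stateTraj A B x₁ u t - stateTraj A B x₂ u t =
      ((A + K * C) ^ t) *ᵥ (x₁ - x₂) -
        ∑ s ∈ Finset.range t, ((A + K * C) ^ s) *ᵥ (K *ᵥ
          (outputMap C D (stateTraj A B x₁ u (t - (s + 1))) (u (t - (s + 1))) -
            outputMap C D (stateTraj A B x₂ u (t - (s + 1))) (u (t - (s + 1))))) := by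
  induction t with
  | zero => simp [stateTraj]
  | succ t ih =>
    have hstep : stateTraj A B x₁ u (t + 1) - stateTraj A B x₂ u (t + 1) =
        (A + K * C) *ᵥ (stateTraj A B x₁ u t - stateTraj A B x₂ u t) -
          K *ᵥ (outputMap C D (stateTraj A B x₁ u t) (u t) -
            outputMap C D (stateTraj A B x₂ u t) (u t)) := by
      simp only [stateTraj, outputMap, Matrix.add_mulVec, Matrix.mulVec_sub, Matrix.mulVec_add,
        ← Matrix.mulVec_mulVec]
      abel
    rw [hstep, ih, Finset.sum_range_succ', Matrix.mulVec_sub, Matrix.mulVec_mulVec, ← pow_succ',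
      Matrix.mulVec_sum]
    simp only [Matrix.mulVec_mulVec _ (A + K * C), ← pow_succ',
      Nat.add_sub_add_right, pow_zero, Matrix.one_mulVec, zero_add, Nat.add_sub_cancel]
    abel

lemma sum_Icc_one_eq_sum_range {M : Type*} [AddCommMonoid M] (f : ℕ → M) (t : ℕ) :
    ∑ τ ∈ Finset.Icc 1 t, f τ = ∑ s ∈ Finset.range t, f (s + 1) := by
  rw [Finset.range_eq_Ico, Finset.sum_Ico_add' f 0 t 1, zero_add]
  rfl

theorem Detectable.exists_isEUOSS {n m p : ℕ} {A : Matrix (Fin n) (Fin n) ℝ}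
    {C : Matrix (Fin p) (Fin n) ℝ} (h : Detectable A C) (B : Matrix (Fin n) (Fin m) ℝ)
    (D : Matrix (Fin p) (Fin m) ℝ) : ∃ p₀ r₀ η : ℝ, IsEUOSS A B C D p₀ r₀ η := by
  obtain ⟨K, hK⟩ := h
  obtain ⟨c, η, hc, hη0, hη1, hF⟩ := hK.exists_vnorm_pow_mulVec_le
  obtain ⟨k, hk0, hk⟩ := exists_vnorm_mulVec_le K
  refine ⟨max 1 c, max 1 (c * k / η), η, le_max_left _ _, le_max_left _ _, hη0, hη1,
    fun x₁ x₂ u t => ?_⟩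
  rw [stateTraj_sub_eq A B C D K]
  refine (vnorm_sub_le _ _).trans (add_le_add ?_ ((vnorm_sum_le _ _).trans ?_))
  · refine (hF t _).trans ?_
    have := vnorm_nonneg (x₁ - x₂)
    rw [mul_right_comm]
    gcongr
    exact le_max_right _ _
  · rw [sum_Icc_one_eq_sum_range]
    refine Finset.sum_le_sum fun s _ => ?_
    set w := outputMap C D (stateTraj A B x₁ u (t - (s + 1))) (u (t - (s + 1))) -
      outputMap C D (stateTraj A B x₂ u (t - (s + 1))) (u (t - (s + 1)))
    have hw := vnorm_nonneg w
    calc _ ≤ c * η ^ s * (k * vnorm w) := (hF s _).trans (by gcongr; exact hk w)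
      _ = c * k / η * vnorm w * η ^ (s + 1) := by rw [pow_succ]; field_simp
      _ ≤ _ := by gcongr; exact le_max_right _ _

end Detectability

/-! ### Trajectories and Hankel matrices -/

section Hankel

lemma vecMul_injective_of_rank_eq_card {κ ι : Type*} [Fintype κ] [Fintype ι]
    {M : Matrix κ ι ℝ} (h : M.rank = Fintype.card κ) : Function.Injective M.vecMul := by
  rw [Matrix.vecMul_injective_iff, linearIndependent_iff_card_eq_finrank_span, ← h,
    Matrix.rank_eq_finrank_span_row, Set.finrank]

lemma mulVec_surjective_of_vecMul_eq_zero {κ ι : Type*} [Fintype κ] [Fintype ι]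
    {M : Matrix κ ι ℝ} (h : ∀ g, g ᵥ* M = 0 → g = 0) : Function.Surjective M.mulVec := by
  have hinj : Function.Injective M.vecMul := fun a b hab =>
    sub_eq_zero.1 (h _ (by rw [Matrix.sub_vecMul]; exact sub_eq_zero.2 hab))
  have hr := (Matrix.vecMul_injective_iff.1 hinj).rank_matrix
  rw [Matrix.rank] at hr
  have htop : LinearMap.range M.mulVecLin = ⊤ :=
    Submodule.eq_top_of_finrank_eq (by rw [hr, Module.finrank_fintype_fun_eq_card])
  exact LinearMap.range_eq_top.1 htop

lemma hankel_mulVec_apply {d depth cols : ℕ} (w : ℕ → Fin d → ℝ) (α : Fin cols → ℝ)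
    (q : Fin depth × Fin d) :
    (hankel depth cols w *ᵥ α) q = (∑ j, α j • w (q.1 + j)) q.2 := by
  simp [hankel, Matrix.mulVec, dotProduct, Finset.sum_apply, mul_comm]

lemma stateTraj_add {n m : ℕ} (A : Matrix (Fin n) (Fin n) ℝ) (B : Matrix (Fin n) (Fin m) ℝ)
    (x₀ : Fin n → ℝ) (u : ℕ → Fin m → ℝ) (s j : ℕ) :
    stateTraj A B (stateTraj A B x₀ u s) (fun k => u (s + k)) j = stateTraj A B x₀ u (s + j) := by
  induction j with
  | zero => rfl
  | succ j ih => rw [stateTraj, ih, ← add_assoc, stateTraj]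

lemma continuous_stateTraj {n m : ℕ} (A : Matrix (Fin n) (Fin n) ℝ)
    (B : Matrix (Fin n) (Fin m) ℝ) (u : ℕ → Fin m → ℝ) (j : ℕ) :
    Continuous fun ξ => stateTraj A B ξ u j := by
  induction j with
  | zero => exact continuous_id
  | succ j ih => simp only [stateTraj]; fun_prop

/-- Variation of constants along a finite trajectory. -/
lemma IsOfflineTrajectory.state_add {n m p : ℕ} {A : Matrix (Fin n) (Fin n) ℝ}
    {B : Matrix (Fin n) (Fin m) ℝ} {C : Matrix (Fin p) (Fin n) ℝ} {D : Matrix (Fin p) (Fin m) ℝ}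
    {N : ℕ} {u : ℕ → Fin m → ℝ} {x : ℕ → Fin n → ℝ} {y : ℕ → Fin p → ℝ}
    (h : IsOfflineTrajectory A B C D N u x y) (j k : ℕ) (hjk : j + k < N) :
    x (j + k) = (A ^ k) *ᵥ x j +
      ∑ l ∈ Finset.range k, (A ^ l) *ᵥ (B *ᵥ u (j + (k - (l + 1)))) := by
  induction k with
  | zero => simp
  | succ k ih =>
    rw [← add_assoc, h.1 _ (by omega), ih (by omega), Finset.sum_range_succ', Matrix.mulVec_add,
      Matrix.mulVec_mulVec, ← pow_succ', Matrix.mulVec_sum]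
    simp only [Matrix.mulVec_mulVec _ A, ← pow_succ', Nat.add_sub_add_right, pow_zero,
      Matrix.one_mulVec, zero_add, Nat.add_sub_cancel]
    rw [add_assoc]

/-- The first `K'` block rows of a Hankel matrix of full row rank satisfy no nontrivial linear
relation. The condition `j + K < N + 1` ranges over the columns of the matrix. -/
lemma PersistentlyExciting.eq_zero_of_sum_eq_zero {m N K K' : ℕ} {u : ℕ → Fin m → ℝ}
    (h : PersistentlyExciting N K u) (hK : K' ≤ K) {V : ℕ → Fin m → ℝ}
    (hV : ∀ j, j + K < N + 1 → ∑ s ∈ Finset.range K', V s ⬝ᵥ u (j + s) = 0) :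
    ∀ s < K', V s = 0 := by
  have hinj := vecMul_injective_of_rank_eq_card
    (M := hankel K (N + 1 - K) u) (by rw [h]; simp [mul_comm])
  let g : Fin K × Fin m → ℝ := fun q => if (q.1 : ℕ) < K' then V q.1 q.2 else 0
  have hg : g = 0 := by
    refine hinj ?_
    change g ᵥ* _ = 0 ᵥ* _
    rw [Matrix.zero_vecMul]
    ext j
    have hj := hV j (by omega)
    have hext : ∑ s ∈ Finset.range K, (if s < K' then V s ⬝ᵥ u (j + s) else 0) =
        ∑ s ∈ Finset.range K', V s ⬝ᵥ u (j + s) := by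
      rw [← Finset.sum_subset (Finset.range_mono hK) (by simp +contextual)]
      exact Finset.sum_congr rfl fun s hs => if_pos (Finset.mem_range.1 hs)
    rw [← hext, ← Fin.sum_univ_eq_sum_range
      (fun s => if s < K' then V s ⬝ᵥ u (j + s) else 0)] at hj
    simp only [Matrix.vecMul, dotProduct, Fintype.sum_prod_type, g, hankel, Matrix.of_apply,
      Pi.zero_apply]
    refine Eq.trans (Finset.sum_congr rfl fun s _ => ?_) hj
    by_cases hs : (s : ℕ) < K' <;> simp [hs, dotProduct, add_comm]
  intro s hs
  ext i
  simpa [g, hs] using congrFun hg (⟨s, by omega⟩, i)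

lemma Controllable.eq_zero {n m : ℕ} {A : Matrix (Fin n) (Fin n) ℝ}
    {B : Matrix (Fin n) (Fin m) ℝ} (h : Controllable A B) {η : Fin n → ℝ}
    (hη : ∀ l < n, η ᵥ* (A ^ l * B) = 0) : η = 0 := by
  refine vecMul_injective_of_rank_eq_card (M := ctrbMatrix A B) (by rw [h]; simp) ?_
  change η ᵥ* _ = 0 ᵥ* _
  rw [Matrix.zero_vecMul]
  ext q
  exact congrFun (hη q.1 q.1.2) q.2

lemma sum_charpoly_coeff_smul_pow {n : ℕ} (A : Matrix (Fin n) (Fin n) ℝ) :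
    ∑ k ∈ Finset.range (n + 1), A.charpoly.coeff k • A ^ k = 0 := by
  have h := A.aeval_self_charpoly
  rwa [Polynomial.aeval_eq_sum_range, A.charpoly_natDegree_eq_dim, Fintype.card_fin] at h

/-- The rank condition behind Willems' fundamental lemma: the matrix formed by the depth-`h`
Hankel matrix of the input and the initial states of its windows has trivial left kernel.

Shifting a left kernel element `k = 0, …, n` times and expressing the states through the one at
the start of the window gives relations whose state parts are `ηᵀ A ^ k`. The combination with the
coefficients of the characteristic polynomial has no state part, so persistency of excitation
makes its input part vanish. That part is the convolution of a monic polynomial with the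
sequence `ξ (h-1), …, ξ 0, ηᵀ B, ηᵀ A B, …`, which therefore vanishes as well. -/
lemma IsOfflineTrajectory.left_kernel_trivial {n m p : ℕ} {A : Matrix (Fin n) (Fin n) ℝ}
    {B : Matrix (Fin n) (Fin m) ℝ} {C : Matrix (Fin p) (Fin n) ℝ} {D : Matrix (Fin p) (Fin m) ℝ}
    {N : ℕ} {u : ℕ → Fin m → ℝ} {x : ℕ → Fin n → ℝ} {y : ℕ → Fin p → ℝ}
    (htraj : IsOfflineTrajectory A B C D N u x y) (hctrb : Controllable A B) {L h : ℕ}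
    (hL : h ≤ L) (hpe : PersistentlyExciting N (L + n + 1) u)
    {ξ : ℕ → Fin m → ℝ} {η : Fin n → ℝ}
    (hker : ∀ j, j + h < N → ∑ i ∈ Finset.range h, ξ i ⬝ᵥ u (i + j) + η ⬝ᵥ x j = 0) :
    (∀ i < h, ξ i = 0) ∧ η = 0 := by
  set W : ℕ → Fin m → ℝ := fun q =>
    if q < h then ξ (h - (q + 1)) else η ᵥ* (A ^ (q - h) * B) with hW
  set a : ℕ → ℝ := fun k => A.charpoly.coeff k with ha
  -- the shifted relations, with all states expressed through `x j`
  have hshift : ∀ j k, j + k + h < N →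
      ∑ q ∈ Finset.range (h + k), W q ⬝ᵥ u (j + (h + k - (q + 1))) + η ⬝ᵥ ((A ^ k) *ᵥ x j)
        = 0 := by
    intro j k hjk
    rw [← hker (j + k) hjk, htraj.state_add j k (by omega), dotProduct_add, dotProduct_sum,
      Finset.sum_range_add, ← Finset.sum_range_reflect (fun i => ξ i ⬝ᵥ u (i + (j + k)))]
    have h1 : ∀ q ∈ Finset.range h, W q ⬝ᵥ u (j + (h + k - (q + 1))) =
        ξ (h - 1 - q) ⬝ᵥ u (h - 1 - q + (j + k)) := by
      intro q hq
      have hq := Finset.mem_range.1 hq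
      rw [hW]
      simp only [hq, if_true]
      rw [show h - (q + 1) = h - 1 - q by omega,
        show j + (h + k - (q + 1)) = h - 1 - q + (j + k) by omega]
    have h2 : ∀ l ∈ Finset.range k, W (h + l) ⬝ᵥ u (j + (h + k - (h + l + 1))) =
        η ⬝ᵥ ((A ^ l) *ᵥ (B *ᵥ u (j + (k - (l + 1))))) := by
      intro l _
      rw [hW]
      simp only [show ¬ h + l < h by omega, if_false, Nat.add_sub_cancel_left]
      rw [← Matrix.dotProduct_mulVec, Matrix.mulVec_mulVec,
        show h + k - (h + l + 1) = k - (l + 1) by omega]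
    rw [Finset.sum_congr rfl h1, Finset.sum_congr rfl h2]
    ring
  have hconv : ∀ s < h + n, ∑ k ∈ Finset.range (n + 1),
      a k • (if s < h + k then W (h + k - (s + 1)) else 0) = 0 := by
    refine hpe.eq_zero_of_sum_eq_zero (by omega) fun j hj => ?_
    have hterm : ∀ k ∈ Finset.range (n + 1), a k * (∑ s ∈ Finset.range (h + n),
        (if s < h + k then W (h + k - (s + 1)) else 0) ⬝ᵥ u (j + s)) +
          η ⬝ᵥ ((a k • A ^ k) *ᵥ x j) = 0 := by
      intro k hk
      have hk := Finset.mem_range.1 hk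
      rw [Matrix.smul_mulVec, dotProduct_smul, smul_eq_mul, ← mul_add]
      convert mul_zero (a k)
      rw [← hshift j k (by omega), ← Finset.sum_range_reflect
        (fun q => W q ⬝ᵥ u (j + (h + k - (q + 1))))]
      congr 1
      rw [← Finset.sum_subset (Finset.range_mono (show h + k ≤ h + n by omega))]
      · refine Finset.sum_congr rfl fun s hs => ?_
        have hs := Finset.mem_range.1 hs
        rw [if_pos hs, show h + k - 1 - s + 1 = h + k - s by omega,
          show h + k - (h + k - s) = s by omega, show h + k - 1 - s = h + k - (s + 1) by omega]
      · intro s _ hs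
        rw [if_neg (by simpa using hs), zero_dotProduct]
    have hsum := Finset.sum_eq_zero hterm
    rw [Finset.sum_add_distrib, ← dotProduct_sum, ← Matrix.sum_mulVec,
      sum_charpoly_coeff_smul_pow, Matrix.zero_mulVec, dotProduct_zero, add_zero] at hsum
    rw [← hsum]
    simp only [sum_dotProduct, smul_dotProduct, smul_eq_mul, Finset.mul_sum]
    exact Finset.sum_comm
  have hWzero : ∀ r < h + n, W r = 0 := by
    intro r
    induction r using Nat.strong_induction_on with
    | _ r ih =>
      intro hr
      have h1 := hconv (h + n - (r + 1)) (by omega)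
      rw [Finset.sum_range_succ, Finset.sum_eq_zero, zero_add, if_pos (by omega)] at h1
      · have hn : a n = 1 := by
          have := A.charpoly_monic.coeff_natDegree
          rwa [A.charpoly_natDegree_eq_dim, Fintype.card_fin] at this
        rwa [hn, one_smul, show h + n - (h + n - (r + 1) + 1) = r by omega] at h1
      · intro k hk
        have hk := Finset.mem_range.1 hk
        split_ifs
        · rw [ih _ (by omega) (by omega), smul_zero]
        · rw [smul_zero]
  refine ⟨fun i hi => ?_, hctrb.eq_zero fun l hl => ?_⟩
  · have h1 := hWzero (h - 1 - i) (by omega)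
    rw [hW] at h1
    simp only [show h - 1 - i < h by omega, if_true] at h1
    rwa [show h - (h - 1 - i + 1) = i by omega] at h1
  · simpa [hW] using hWzero (h + l) (by omega)

/-- Willems' fundamental lemma: every input window and every initial state are reproduced by a
combination of windows of a persistently exciting trajectory. -/
lemma IsOfflineTrajectory.exists_alpha {n m p : ℕ} {A : Matrix (Fin n) (Fin n) ℝ}
    {B : Matrix (Fin n) (Fin m) ℝ} {C : Matrix (Fin p) (Fin n) ℝ} {D : Matrix (Fin p) (Fin m) ℝ}
    {N : ℕ} {ud : ℕ → Fin m → ℝ} {xd : ℕ → Fin n → ℝ} {yd : ℕ → Fin p → ℝ}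
    (htraj : IsOfflineTrajectory A B C D N ud xd yd) (hctrb : Controllable A B) {L h : ℕ}
    (hL : h ≤ L) (hpe : PersistentlyExciting N (L + n + 1) ud)
    (u : ℕ → Fin m → ℝ) (ξ : Fin n → ℝ) :
    ∃ α : Fin (N - h) → ℝ, hankel h (N - h) ud *ᵥ α = (fun q => u q.1 q.2) ∧
      ∑ j, α j • xd j = ξ := by
  let M : Matrix ((Fin h × Fin m) ⊕ Fin n) (Fin (N - h)) ℝ :=
    Matrix.fromRows (hankel h (N - h) ud) (Matrix.of fun i j => xd j i)
  have hM : Function.Surjective M.mulVec := by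
    refine mulVec_surjective_of_vecMul_eq_zero fun g hg => ?_
    obtain ⟨h1, h2⟩ := htraj.left_kernel_trivial hctrb hL hpe
      (ξ := fun i => if hi : i < h then fun k => g (Sum.inl (⟨i, hi⟩, k)) else 0)
      (η := fun i => g (Sum.inr i)) (fun j hj => by
        have := congrFun hg ⟨j, by omega⟩
        simp only [Matrix.vecMul, dotProduct, Fintype.sum_sum_type, M, Matrix.fromRows_apply_inl,
          Matrix.fromRows_apply_inr, Fintype.sum_prod_type, hankel, Matrix.of_apply,
          Pi.zero_apply] at this
        rw [← this, ← Fin.sum_univ_eq_sum_range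
          (fun i => (if hi : i < h then fun k => g (Sum.inl (⟨i, hi⟩, k)) else 0) ⬝ᵥ ud (i + j))]
        simp [dotProduct])
    ext (⟨i, k⟩ | i)
    · simpa using congrFun (h1 i i.2) k
    · exact congrFun h2 i
  obtain ⟨α, hα⟩ := hM (Sum.elim (fun q => u q.1 q.2) ξ)
  rw [Matrix.fromRows_mulVec] at hα
  refine ⟨α, funext fun q => congrFun hα (Sum.inl q), funext fun i => ?_⟩
  rw [← show _ = ξ i from congrFun hα (Sum.inr i)]
  simp [Matrix.mulVec, dotProduct, mul_comm]

/-- Conversely, combinations of windows of a trajectory are trajectories. -/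
lemma IsOfflineTrajectory.combination {n m p : ℕ} {A : Matrix (Fin n) (Fin n) ℝ}
    {B : Matrix (Fin n) (Fin m) ℝ} {C : Matrix (Fin p) (Fin n) ℝ} {D : Matrix (Fin p) (Fin m) ℝ}
    {N : ℕ} {ud : ℕ → Fin m → ℝ} {xd : ℕ → Fin n → ℝ} {yd : ℕ → Fin p → ℝ}
    (htraj : IsOfflineTrajectory A B C D N ud xd yd) {h : ℕ} {u : ℕ → Fin m → ℝ}
    {α : Fin (N - h) → ℝ} (hα : hankel h (N - h) ud *ᵥ α = fun q => u q.1 q.2) :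
    (∀ i ≤ h, ∑ j : Fin (N - h), α j • xd (i + j) =
      stateTraj A B (∑ j : Fin (N - h), α j • xd j) u i) ∧
    ∀ i < h, ∑ j : Fin (N - h), α j • yd (i + j) =
      outputMap C D (stateTraj A B (∑ j : Fin (N - h), α j • xd j) u i) (u i) := by
  have hu : ∀ i < h, ∑ j : Fin (N - h), α j • ud (i + j) = u i := fun i hi => by
    ext k
    rw [← show _ = u i k from congrFun hα (⟨i, hi⟩, k), hankel_mulVec_apply]
  have hx : ∀ i ≤ h, ∑ j : Fin (N - h), α j • xd (i + j) =
      stateTraj A B (∑ j : Fin (N - h), α j • xd j) u i := by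
    intro i
    induction i with
    | zero => simp [stateTraj]
    | succ i ih =>
      intro hi
      rw [stateTraj, ← ih (by omega), ← hu i (by omega), Matrix.mulVec_sum, Matrix.mulVec_sum,
        ← Finset.sum_add_distrib]
      refine Finset.sum_congr rfl fun j _ => ?_
      rw [Matrix.mulVec_smul, Matrix.mulVec_smul, ← smul_add, add_right_comm,
        htraj.1 _ (by omega)]
  refine ⟨hx, fun i hi => ?_⟩
  rw [outputMap, ← hx i hi.le, ← hu i hi, Matrix.mulVec_sum, Matrix.mulVec_sum,
    ← Finset.sum_add_distrib]
  refine Finset.sum_congr rfl fun j _ => ?_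
  rw [Matrix.mulVec_smul, Matrix.mulVec_smul, ← smul_add, htraj.2 _ (by omega)]

end Hankel

/-! ### The optimization problem in terms of the model -/

section Estimator

variable {n m p : ℕ} {A : Matrix (Fin n) (Fin n) ℝ} {B : Matrix (Fin n) (Fin m) ℝ}
  {C : Matrix (Fin p) (Fin n) ℝ} {D : Matrix (Fin p) (Fin m) ℝ} {S : Scheme n m p}

/-- The data-driven constraints force the decision variables to be a trajectory of the system,
which is determined by its first state. -/
lemma Scheme.Feasible.eq_stateTraj (htraj : IsOfflineTrajectory A B C D S.N S.ud S.xd S.yd)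
    {h t : ℕ} {u : ℕ → Fin m → ℝ} {y : ℕ → Fin p → ℝ} {z : Decision n p S.N h}
    (hz : S.Feasible h t u y z) :
    (∀ j, z.xbar j = stateTraj A B (z.xbar 0) (fun k => u (t - h + k)) j) ∧
      ∀ j, z.sigma j = y (t - h + j) -
        outputMap C D (stateTraj A B (z.xbar 0) (fun k => u (t - h + k)) j) (u (t - h + j)) := by
  obtain ⟨hu, hy, hx, -⟩ := hz
  obtain ⟨h1, h2⟩ := htraj.combination (u := fun k => u (t - h + k)) hu
  have hx' : ∀ i : Fin (h + 1), z.xbar i = ∑ j, z.alpha j • S.xd (i + j) := fun i => by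
    ext k
    rw [← show _ = z.xbar i k from congrFun hx (i, k), hankel_mulVec_apply]
  have h0 : z.xbar 0 = ∑ j, z.alpha j • S.xd j := by simpa using hx' 0
  refine ⟨fun i => ?_, fun i => ?_⟩
  · rw [hx', h0, h1 i (by omega)]
  · rw [h0, ← h2 i i.2]
    ext k
    have := congrFun hy (i, k)
    rw [hankel_mulVec_apply] at this
    simp only [Pi.sub_apply]
    linarith

/-- Every admissible trajectory of the system is feasible for the data-driven problem. -/
lemma Scheme.exists_feasible (htraj : IsOfflineTrajectory A B C D S.N S.ud S.xd S.yd)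
    (hctrb : Controllable A B) {L h : ℕ} (hL : h ≤ L)
    (hpe : PersistentlyExciting S.N (L + n + 1) S.ud) (t : ℕ) (u : ℕ → Fin m → ℝ)
    (y : ℕ → Fin p → ℝ) (ξ : Fin n → ℝ)
    (hX : ∀ j ≤ h, stateTraj A B ξ (fun k => u (t - h + k)) j ∈ S.X) :
    ∃ z : Decision n p S.N h, S.Feasible h t u y z ∧ z.xbar 0 = ξ := by
  obtain ⟨α, hα, hξ⟩ := htraj.exists_alpha hctrb hL hpe (fun k => u (t - h + k)) ξ
  obtain ⟨h1, h2⟩ := htraj.combination (u := fun k => u (t - h + k)) hα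
  rw [hξ] at h1 h2
  refine ⟨⟨fun j => stateTraj A B ξ (fun k => u (t - h + k)) j, α, fun j => y (t - h + j) -
    outputMap C D (stateTraj A B ξ (fun k => u (t - h + k)) j) (u (t - h + j))⟩,
    ⟨hα, ?_, ?_, fun j => hX j (by omega)⟩, rfl⟩
  · ext q
    rw [hankel_mulVec_apply, h2 _ q.1.2]
    simp
  · ext q
    rw [hankel_mulVec_apply, h1 _ (by omega)]

lemma sum_fin_eq_sum_Icc (f : ℕ → ℝ) (h : ℕ) :
    ∑ j : Fin h, f j = ∑ k ∈ Finset.Icc 1 h, f (h - k) := by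
  rw [Fin.sum_univ_eq_sum_range, sum_Icc_one_eq_sum_range, ← Finset.sum_range_reflect]
  refine Finset.sum_congr rfl fun j _ => ?_
  rw [add_comm j 1, Nat.sub_sub]

/-- The cost of the trajectory with first state `ξ` over the window `[t - h, t]`. -/
noncomputable def modelCost (A : Matrix (Fin n) (Fin n) ℝ) (B : Matrix (Fin n) (Fin m) ℝ)
    (C : Matrix (Fin p) (Fin n) ℝ) (D : Matrix (Fin p) (Fin m) ℝ) (S : Scheme n m p) (h t : ℕ)
    (u : ℕ → Fin m → ℝ) (y : ℕ → Fin p → ℝ) (prior ξ : Fin n → ℝ) : ℝ :=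
  wnorm S.P (ξ - prior) ^ 2 * S.ρ ^ h + ∑ k ∈ Finset.Icc 1 h,
    wnorm S.R (y (t - h + (h - k)) -
      outputMap C D (stateTraj A B ξ (fun k => u (t - h + k)) (h - k)) (u (t - h + (h - k)))) ^ 2
      * S.ρ ^ k

lemma Scheme.Feasible.cost_eq (htraj : IsOfflineTrajectory A B C D S.N S.ud S.xd S.yd)
    {h t : ℕ} {u : ℕ → Fin m → ℝ} {y : ℕ → Fin p → ℝ} {z : Decision n p S.N h}
    (hz : S.Feasible h t u y z) (prior : Fin n → ℝ) :
    S.cost h prior z = modelCost A B C D S h t u y prior (z.xbar 0) := by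
  rw [Scheme.cost, modelCost]
  congr 1
  simp only [(hz.eq_stateTraj htraj).2]
  rw [sum_fin_eq_sum_Icc (fun j => wnorm S.R (y (t - h + j) - outputMap C D
    (stateTraj A B (z.xbar 0) (fun k => u (t - h + k)) j) (u (t - h + j))) ^ 2 * S.ρ ^ (h - j))]
  refine Finset.sum_congr rfl fun k hk => ?_
  rw [Nat.sub_sub_self (Finset.mem_Icc.1 hk).2]

/-! ### Existence of the estimates -/

/-- The cost is continuous and coercive in the first state, so it attains its minimum over a
closed set. -/
lemma Scheme.exists_isOptimal (htraj : IsOfflineTrajectory A B C D S.N S.ud S.xd S.yd)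
    (hctrb : Controllable A B) {L h : ℕ} (hL : h ≤ L)
    (hpe : PersistentlyExciting S.N (L + n + 1) S.ud) (hP : S.P.PosDef) (hP1 : 1 ≤ lambdaMin S.P)
    (hρ : 0 < S.ρ) (hX : IsClosed S.X) (t : ℕ) (u : ℕ → Fin m → ℝ)
    (y : ℕ → Fin p → ℝ) (prior ξ₀ : Fin n → ℝ)
    (hξ₀ : ∀ j, stateTraj A B ξ₀ (fun k => u (t - h + k)) j ∈ S.X) :
    ∃ z : Decision n p S.N h, S.IsOptimal h t u y prior z := by
  set F := modelCost A B C D S h t u y prior with hF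
  set s : Set (Fin n → ℝ) :=
    ⋂ j : Fin (h + 1), (fun ξ => stateTraj A B ξ (fun k => u (t - h + k)) j) ⁻¹' S.X with hs
  have hsc : IsClosed s := isClosed_iInter fun j => hX.preimage (continuous_stateTraj A B _ _)
  have hFc : Continuous F := by
    unfold F modelCost
    refine .add ((((continuous_wnorm _).comp (by fun_prop)).pow 2).mul_const _)
      (continuous_finsetSum _ fun k _ => (((continuous_wnorm _).comp ?_).pow 2).mul_const _)
    have := continuous_stateTraj A B (fun k => u (t - h + k)) (h - k)
    unfold outputMap
    fun_prop
  have hlow : ∀ ξ, vnorm (ξ - prior) ^ 2 * S.ρ ^ h ≤ F ξ := fun ξ => by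
    have h1 : vnorm (ξ - prior) ^ 2 ≤ wnorm S.P (ξ - prior) ^ 2 := by
      rw [wnorm_sq hP]
      exact (le_mul_of_one_le_left (sq_nonneg _) hP1).trans (lambdaMin_mul_sq_le hP _)
    have h2 := mul_le_mul_of_nonneg_right h1 (pow_pos hρ h).le
    exact h2.trans (le_add_of_nonneg_right (Finset.sum_nonneg fun k _ => by positivity))
  have hcoer : ∀ᶠ ξ in Filter.cocompact (Fin n → ℝ), F ξ₀ ≤ F ξ := by
    filter_upwards [(tendsto_norm_cocompact_atTop (E := Fin n → ℝ)).eventually_ge_atTop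
      (‖prior‖ + (1 + F ξ₀ / S.ρ ^ h))] with ξ hξ
    have hF0 : 0 ≤ F ξ₀ := le_trans (by positivity) (hlow ξ₀)
    have h1 : 1 + F ξ₀ / S.ρ ^ h ≤ vnorm (ξ - prior) := by
      have := norm_sub_norm_le ξ prior
      have := norm_le_vnorm (ξ - prior)
      linarith
    have h0 : 0 ≤ F ξ₀ / S.ρ ^ h := by positivity
    have h2 : F ξ₀ / S.ρ ^ h ≤ vnorm (ξ - prior) ^ 2 := by nlinarith
    exact ((div_le_iff₀ (by positivity)).1 h2).trans (hlow ξ)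
  obtain ⟨ξ, hξ, hmin⟩ := hFc.continuousOn.exists_isMinOn' hsc
    (Set.mem_iInter.2 fun j => hξ₀ j) (hcoer.filter_mono inf_le_left)
  obtain ⟨z, hz, rfl⟩ := S.exists_feasible htraj hctrb hL hpe t u y ξ
    (fun j hj => Set.mem_iInter.1 hξ ⟨j, by omega⟩)
  refine ⟨z, hz, fun z' hz' => ?_⟩
  rw [hz.cost_eq htraj, hz'.cost_eq htraj]
  refine hmin (Set.mem_iInter.2 fun j => ?_)
  rw [Set.mem_preimage, ← (hz'.eq_stateTraj htraj).1]
  exact hz'.2.2.2 j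

/-- The two phases of the estimator differ only in the horizon, which is `min L t`. -/
lemma Scheme.isEstimate_iff {L : ℕ} {xhat₀ : Fin n → ℝ} {u : ℕ → Fin m → ℝ} {y : ℕ → Fin p → ℝ}
    {xhat : ℕ → Fin n → ℝ} :
    S.IsEstimate L xhat₀ u y xhat ↔ xhat 0 = xhat₀ ∧
      ∀ t, 0 < t → ∃ z : Decision n p S.N (min L t),
        S.IsOptimal (min L t) t u y (xhat (t - min L t)) z ∧
          xhat t = z.xbar (Fin.last (min L t)) := by
  refine and_congr_right fun _ => ⟨fun ⟨h1, h2⟩ t ht => ?_, fun h => ⟨fun t ht htL => ?_,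
    fun t ht htL => ?_⟩⟩
  · obtain hlt | hle := lt_or_ge t L
    · rw [min_eq_right hlt.le, Nat.sub_self]
      exact h1 t ht hlt
    · rw [min_eq_left hle]
      exact h2 t ht hle
  · have := h t ht
    rwa [min_eq_right htL.le, Nat.sub_self] at this
  · have := h t ht
    rwa [min_eq_left htL] at this

/-- The recursion `w (t + 1) = g (t + 1) (w (t + 1 - L))`; truncated subtraction makes `w 0` the
argument as long as `t + 1 ≤ L`. -/
def delayRec {E : Type*} (L : ℕ) (hL : 0 < L) (g : ℕ → E → E) (w₀ : E) : ℕ → E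
  | 0 => w₀
  | t + 1 => g (t + 1) (delayRec L hL g w₀ (t + 1 - L))

lemma Scheme.exists_isEstimate (htraj : IsOfflineTrajectory A B C D S.N S.ud S.xd S.yd)
    (hctrb : Controllable A B) {L : ℕ} (hL : 0 < L)
    (hpe : PersistentlyExciting S.N (L + n + 1) S.ud) (hP : S.P.PosDef) (hP1 : 1 ≤ lambdaMin S.P)
    (hρ : 0 < S.ρ) (hX : IsClosed S.X) {x₀ : Fin n → ℝ} {u : ℕ → Fin m → ℝ}
    (hx : ∀ t, stateTraj A B x₀ u t ∈ S.X) (xhat₀ : Fin n → ℝ) (y : ℕ → Fin p → ℝ) :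
    ∃ xhat, S.IsEstimate L xhat₀ u y xhat := by
  have hopt : ∀ t prior, ∃ z : Decision n p S.N (min L t),
      S.IsOptimal (min L t) t u y prior z := fun t prior =>
    S.exists_isOptimal htraj hctrb (min_le_left L t) hpe hP hP1 hρ hX t u y prior
      (stateTraj A B x₀ u (t - min L t)) (fun j => by rw [stateTraj_add]; exact hx _)
  choose z hz using hopt
  refine ⟨delayRec L hL (fun t prior => (z t prior).xbar (Fin.last _)) xhat₀,
    Scheme.isEstimate_iff.2 ⟨by rw [delayRec], fun t ht => ⟨_, hz t _, ?_⟩⟩⟩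
  obtain ⟨t, rfl⟩ := Nat.exists_eq_add_one.2 ht
  rw [delayRec, show t + 1 - min L (t + 1) = t + 1 - L by omega]

/-! ### Stability -/

/-- A bound on the cost turns the output-to-state estimate over one window into one in terms of
the prior error `e₀` and the noise `v`; `e₁` and `s` are the sizes of the correction of the prior
and of the fitted noise. The square roots in the cost turn `ρ` into `√ρ`. -/
lemma window_error_le {ρ p₀ r₀ Mp Mr e₀ e₁ : ℝ} (hρ : ρ ∈ Set.Ioo (0 : ℝ) 1) (hp₀ : 1 ≤ p₀)
    (hr₀ : 1 ≤ r₀) (hMp : 0 ≤ Mp) (hMr : 0 ≤ Mr) (he₀ : 0 ≤ e₀) {h : ℕ}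
    {s v : ℕ → ℝ} (hv : ∀ k, 0 ≤ v k)
    (hcost : p₀ * e₁ ^ 2 * ρ ^ h + ∑ k ∈ Finset.Icc 1 h, r₀ * s k ^ 2 * ρ ^ k ≤
      Mp * e₀ ^ 2 * ρ ^ h + ∑ k ∈ Finset.Icc 1 h, Mr * v k ^ 2 * ρ ^ k) :
    p₀ * (e₀ + e₁) * ρ ^ h + ∑ k ∈ Finset.Icc 1 h, r₀ * (s k + v k) * ρ ^ k ≤
      (p₀ + (p₀ + r₀ / (1 - ρ)) * √Mp) * e₀ * √ρ ^ h +
        ∑ k ∈ Finset.Icc 1 h, (r₀ + (p₀ + r₀ / (1 - ρ)) * √Mr) * v k * √ρ ^ k := by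
  obtain ⟨hρ0, hρ1⟩ := hρ
  have hμ0 : 0 < √ρ := Real.sqrt_pos.2 hρ0
  have hμ2 : √ρ ^ 2 = ρ := Real.sq_sqrt hρ0.le
  have hroot : ρ ≤ √ρ := by nlinarith [Real.sqrt_le_one.2 hρ1.le]
  have hpow2 : ∀ k : ℕ, ρ ^ k = (√ρ ^ k) ^ 2 := fun k => by rw [← pow_mul', pow_mul, hμ2]
  set G := r₀ / (1 - ρ) with hG
  have hG1 : 1 ≤ G := (one_le_div (by linarith)).2 (by linarith)
  set V := ∑ k ∈ Finset.Icc 1 h, v k * √ρ ^ k with hV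
  have hV0 : 0 ≤ V := Finset.sum_nonneg fun k _ => mul_nonneg (hv k) (by positivity)
  set T := √Mp * e₀ * √ρ ^ h + √Mr * V with hT
  have hT0 : 0 ≤ T := by positivity
  have hs2 : 0 ≤ ∑ k ∈ Finset.Icc 1 h, r₀ * s k ^ 2 * ρ ^ k :=
    Finset.sum_nonneg fun k _ => by positivity
  have hJ : p₀ * e₁ ^ 2 * ρ ^ h + ∑ k ∈ Finset.Icc 1 h, r₀ * s k ^ 2 * ρ ^ k ≤ T ^ 2 := by
    have h1 : ∑ k ∈ Finset.Icc 1 h, Mr * v k ^ 2 * ρ ^ k ≤ (√Mr * V) ^ 2 := by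
      rw [mul_pow, Real.sq_sqrt hMr]
      simp only [mul_assoc, ← Finset.mul_sum]
      refine mul_le_mul_of_nonneg_left ?_ hMr
      simp only [hpow2, ← mul_pow]
      exact Finset.sum_sq_le_sq_sum_of_nonneg fun k _ => mul_nonneg (hv k) (by positivity)
    have h2 : Mp * e₀ ^ 2 * ρ ^ h = (√Mp * e₀ * √ρ ^ h) ^ 2 := by
      rw [mul_pow, mul_pow, Real.sq_sqrt hMp, hpow2]
    have h3 : 0 ≤ (√Mp * e₀ * √ρ ^ h) * (√Mr * V) := by positivity
    nlinarith
  have hT1 : p₀ * e₁ * ρ ^ h ≤ p₀ * T := by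
    refine le_of_abs_le (abs_le_of_sq_le_sq ?_ (by positivity))
    have hle : ρ ^ h ≤ 1 := pow_le_one₀ hρ0.le hρ1.le
    calc (p₀ * e₁ * ρ ^ h) ^ 2 = p₀ * ρ ^ h * (p₀ * e₁ ^ 2 * ρ ^ h) := by ring
      _ ≤ p₀ * p₀ * T ^ 2 := by
          gcongr
          · exact hle.trans hp₀
          · linarith
      _ = _ := by ring
  have hT2 : ∑ k ∈ Finset.Icc 1 h, r₀ * s k * ρ ^ k ≤ G * T := by
    refine le_of_abs_le (abs_le_of_sq_le_sq ?_ (by positivity))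
    have hgeo : ∑ k ∈ Finset.Icc 1 h, r₀ * ρ ^ k ≤ G := by
      rw [← Finset.mul_sum, hG, div_eq_mul_inv]
      gcongr
      rw [← tsum_geometric_of_lt_one hρ0.le hρ1]
      exact (summable_geometric_of_lt_one hρ0.le hρ1).sum_le_tsum _ fun k _ => by positivity
    calc (∑ k ∈ Finset.Icc 1 h, r₀ * s k * ρ ^ k) ^ 2
        ≤ (∑ k ∈ Finset.Icc 1 h, r₀ * ρ ^ k) * ∑ k ∈ Finset.Icc 1 h, r₀ * s k ^ 2 * ρ ^ k :=
          Finset.sum_sq_le_sum_mul_sum_of_sq_le_mul _ (fun k _ => by positivity)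
            (fun k _ => by positivity) (fun k _ => le_of_eq (by ring))
      _ ≤ G * T ^ 2 := by
          gcongr
          have : 0 ≤ p₀ * e₁ ^ 2 * ρ ^ h := by positivity
          linarith
      _ ≤ G * G * T ^ 2 := by gcongr; exact le_mul_of_one_le_left (by linarith) hG1
      _ = _ := by ring
  have h4 : ∑ k ∈ Finset.Icc 1 h, r₀ * v k * ρ ^ k ≤ r₀ * V := by
    rw [hV, Finset.mul_sum]
    refine Finset.sum_le_sum fun k _ => ?_
    rw [mul_assoc]
    gcongr
    exact hv k
  have h5 : p₀ * e₀ * ρ ^ h ≤ p₀ * e₀ * √ρ ^ h := by gcongr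
  have h6 : ∑ k ∈ Finset.Icc 1 h, r₀ * (s k + v k) * ρ ^ k =
      ∑ k ∈ Finset.Icc 1 h, r₀ * s k * ρ ^ k + ∑ k ∈ Finset.Icc 1 h, r₀ * v k * ρ ^ k := by
    rw [← Finset.sum_add_distrib]
    exact Finset.sum_congr rfl fun k _ => by ring
  have h7 : ∑ k ∈ Finset.Icc 1 h, (r₀ + (p₀ + G) * √Mr) * v k * √ρ ^ k =
      (r₀ + (p₀ + G) * √Mr) * V := by
    rw [hV, Finset.mul_sum]
    exact Finset.sum_congr rfl fun k _ => by ring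
  rw [h6, h7]
  calc _ = p₀ * e₀ * ρ ^ h + p₀ * e₁ * ρ ^ h + (∑ k ∈ Finset.Icc 1 h, r₀ * s k * ρ ^ k +
        ∑ k ∈ Finset.Icc 1 h, r₀ * v k * ρ ^ k) := by ring
    _ ≤ p₀ * e₀ * √ρ ^ h + p₀ * T + (G * T + r₀ * V) := by gcongr
    _ = _ := by rw [hT]; ring

/-- The error over one window, in terms of the error of the prior and of the noise. The constant
is independent of the offline data and of the horizon. -/
lemma exists_window_error_le {P : Matrix (Fin n) (Fin n) ℝ} {R : Matrix (Fin p) (Fin p) ℝ}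
    {ρ p₀ r₀ η : ℝ} (hctrb : Controllable A B) (hP : P.PosDef) (hR : R.PosDef)
    (hρ : ρ ∈ Set.Ioo (0 : ℝ) 1) (hss : IsEUOSS A B C D p₀ r₀ η) (hη : η ≤ ρ)
    (hp₀ : p₀ ≤ lambdaMin P) (hr₀ : r₀ ≤ lambdaMin R) :
    ∃ c : ℝ, 1 ≤ c ∧ ∀ S : Scheme n m p, S.P = P → S.R = R → S.ρ = ρ →
      IsOfflineTrajectory A B C D S.N S.ud S.xd S.yd →
      ∀ L h t : ℕ, h ≤ L → h ≤ t → PersistentlyExciting S.N (L + n + 1) S.ud →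
      ∀ (x₀ : Fin n → ℝ) (u : ℕ → Fin m → ℝ) (v : ℕ → Fin p → ℝ),
      (∀ t, stateTraj A B x₀ u t ∈ S.X) → ∀ (prior : Fin n → ℝ) (z : Decision n p S.N h),
      S.IsOptimal h t u (noisyOutput A B C D x₀ u v) prior z →
      vnorm (stateTraj A B x₀ u t - z.xbar (Fin.last h)) ≤
        c * vnorm (stateTraj A B x₀ u (t - h) - prior) * √ρ ^ h +
          ∑ τ ∈ Finset.Icc 1 h, c * vnorm (v (t - τ)) * √ρ ^ τ := by
  obtain ⟨hp1, hr1, hη0, hη1, hss⟩ := hss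
  obtain ⟨Mp, hMp, hMp'⟩ := exists_dotProduct_mulVec_le P
  obtain ⟨Mr, hMr, hMr'⟩ := exists_dotProduct_mulVec_le R
  obtain ⟨hρ0, hρ1⟩ := id hρ
  set c₁ := p₀ + (p₀ + r₀ / (1 - ρ)) * √Mp
  set c₂ := r₀ + (p₀ + r₀ / (1 - ρ)) * √Mr
  have hG : 0 ≤ r₀ / (1 - ρ) := div_nonneg (by linarith) (by linarith)
  have hc₁ : 1 ≤ c₁ := hp1.trans (le_add_of_nonneg_right (by positivity))
  refine ⟨max c₁ c₂, hc₁.trans (le_max_left _ _), ?_⟩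
  rintro S rfl rfl rfl htraj L h t hhL hht hpe x₀ u v hx prior z hz
  set ũ : ℕ → Fin m → ℝ := fun k => u (t - h + k) with hũ
  set y := noisyOutput A B C D x₀ u v with hy
  set xs := stateTraj A B x₀ u (t - h) with hxs
  have hxt : ∀ j, stateTraj A B xs ũ j = stateTraj A B x₀ u (t - h + j) :=
    stateTraj_add A B x₀ u (t - h)
  -- the fitted noise
  set sig : ℕ → Fin p → ℝ := fun k => y (t - h + (h - k)) -
    outputMap C D (stateTraj A B (z.xbar 0) ũ (h - k)) (u (t - h + (h - k))) with hsig
  obtain ⟨z', hz', hz'0⟩ := S.exists_feasible htraj hctrb hhL hpe t u y xs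
    (fun j _ => by rw [hxt]; exact hx _)
  have hle := hz.2 z' hz'
  rw [hz.1.cost_eq htraj, hz'.cost_eq htraj, hz'0, modelCost, modelCost] at hle
  have hnoise : ∀ k ∈ Finset.Icc 1 h, y (t - h + (h - k)) -
      outputMap C D (stateTraj A B xs ũ (h - k)) (u (t - h + (h - k))) = v (t - k) := by
    intro k hk
    have hk := Finset.mem_Icc.1 hk
    rw [hxt, hy, noisyOutput, add_sub_cancel_left, show t - h + (h - k) = t - k by omega]
  have hcost : p₀ * vnorm (z.xbar 0 - prior) ^ 2 * S.ρ ^ h +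
      ∑ k ∈ Finset.Icc 1 h, r₀ * vnorm (sig k) ^ 2 * S.ρ ^ k ≤
      Mp * vnorm (xs - prior) ^ 2 * S.ρ ^ h +
        ∑ k ∈ Finset.Icc 1 h, Mr * vnorm (v (t - k)) ^ 2 * S.ρ ^ k := by
    refine le_trans (add_le_add ?_ (Finset.sum_le_sum fun k _ => ?_))
      (hle.trans (add_le_add ?_ (Finset.sum_le_sum fun k hk => ?_)))
    · gcongr
      rw [wnorm_sq hP]
      exact (mul_le_mul_of_nonneg_right hp₀ (sq_nonneg _)).trans (lambdaMin_mul_sq_le hP _)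
    · gcongr
      rw [wnorm_sq hR]
      exact (mul_le_mul_of_nonneg_right hr₀ (sq_nonneg _)).trans (lambdaMin_mul_sq_le hR _)
    · gcongr
      rw [wnorm_sq hP]
      exact hMp' _
    · rw [hnoise k hk]
      gcongr
      rw [wnorm_sq hR]
      exact hMr' _
  have hwin := window_error_le hρ hp1 hr1 hMp hMr (vnorm_nonneg _)
    (s := fun k => vnorm (sig k)) (fun k => vnorm_nonneg (v (t - k))) hcost
  have herr := hss xs (z.xbar 0) ũ h
  rw [hxt, Nat.sub_add_cancel hht] at herr
  rw [show z.xbar (Fin.last h) = stateTraj A B (z.xbar 0) ũ h by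
    simpa using (hz.1.eq_stateTraj htraj).1 (Fin.last h)]
  refine herr.trans (le_trans (add_le_add ?_ (Finset.sum_le_sum fun k hk => ?_))
    (hwin.trans (add_le_add ?_ (Finset.sum_le_sum fun k _ => ?_))))
  · have h1 : vnorm (xs - z.xbar 0) ≤ vnorm (xs - prior) + vnorm (z.xbar 0 - prior) := by
      simpa using vnorm_sub_le (xs - prior) (z.xbar 0 - prior)
    have h0 := (vnorm_nonneg (xs - z.xbar 0)).trans h1
    gcongr
  · have h1 : vnorm (outputMap C D (stateTraj A B xs ũ (h - k)) (ũ (h - k)) -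
        outputMap C D (stateTraj A B (z.xbar 0) ũ (h - k)) (ũ (h - k))) ≤
        vnorm (sig k) + vnorm (v (t - k)) := by
      refine le_trans (le_of_eq ?_) (vnorm_sub_le (sig k) (v (t - k)))
      rw [← hnoise k hk]
      simp [hsig, hũ]
    have h0 := (vnorm_nonneg _).trans h1
    gcongr
  · gcongr
    exacts [vnorm_nonneg _, le_max_left _ _]
  · gcongr
    exacts [vnorm_nonneg _, le_max_right _ _]

/-- Iterating the window estimate: for horizons with `c * lam ^ L ≤ 1` the constant `c` is absorbed
by the gain from `lam ^ 2` to `lam`, so it does not accumulate from window to window. -/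
lemma error_le_of_window_error_le {e v : ℕ → ℝ} {c lam : ℝ} {L : ℕ} (hL : 0 < L) (hc : 1 ≤ c)
    (hlam : 0 < lam) (hlam1 : lam ≤ 1) (hcL : c * lam ^ L ≤ 1) (he : ∀ t, 0 ≤ e t)
    (hv : ∀ t, 0 ≤ v t)
    (hstep : ∀ t, 0 < t → e t ≤ c * e (t - min L t) * (lam ^ 2) ^ min L t +
      ∑ τ ∈ Finset.Icc 1 (min L t), c * v (t - τ) * (lam ^ 2) ^ τ) (t : ℕ) :
    e t ≤ c * e 0 * lam ^ t + ∑ τ ∈ Finset.Icc 1 t, c * v (t - τ) * lam ^ τ := by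
  have hlam2 : lam ^ 2 ≤ lam := by nlinarith
  induction t using Nat.strong_induction_on with
  | _ t ih =>
    rcases Nat.eq_zero_or_pos t with rfl | ht
    · simpa using le_mul_of_one_le_left (he 0) hc
    refine (hstep t ht).trans ?_
    obtain hlt | hle := lt_or_ge t L
    · rw [min_eq_right hlt.le, Nat.sub_self]
      gcongr with k _
      · exact mul_nonneg (by linarith) (he 0)
      · exact mul_nonneg (by linarith) (hv _)
    · rw [min_eq_left hle]
      have h1 : c * e (t - L) * (lam ^ 2) ^ L ≤ lam ^ L * e (t - L) := by
        have := mul_le_mul_of_nonneg_right hcL (mul_nonneg (pow_pos hlam L).le (he (t - L)))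
        calc _ = c * lam ^ L * (lam ^ L * e (t - L)) := by ring
          _ ≤ _ := by simpa using this
      have h2 := mul_le_mul_of_nonneg_left (ih (t - L) (by omega)) (pow_pos hlam L).le
      have h3 : ∑ τ ∈ Finset.Icc 1 L, c * v (t - τ) * (lam ^ 2) ^ τ ≤
          ∑ τ ∈ Finset.Icc 1 L, c * v (t - τ) * lam ^ τ := by
        gcongr with k _
        exact mul_nonneg (by linarith) (hv _)
      have h4 : ∑ τ ∈ Finset.Icc 1 t, c * v (t - τ) * lam ^ τ =
          ∑ τ ∈ Finset.Icc 1 L, c * v (t - τ) * lam ^ τ +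
            lam ^ L * ∑ τ ∈ Finset.Icc 1 (t - L), c * v (t - L - τ) * lam ^ τ := by
        obtain ⟨q, rfl⟩ := Nat.exists_eq_add_of_le hle
        rw [sum_Icc_one_eq_sum_range, sum_Icc_one_eq_sum_range, sum_Icc_one_eq_sum_range,
          Nat.add_sub_cancel_left, Finset.sum_range_add, Finset.mul_sum]
        congr 1
        refine Finset.sum_congr rfl fun k _ => ?_
        rw [show L + q - (L + k + 1) = q - (k + 1) by omega]
        ring
      have h5 : lam ^ L * (c * e 0 * lam ^ (t - L)) = c * e 0 * lam ^ t := by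
        rw [mul_left_comm, ← pow_add, Nat.add_sub_cancel' hle]
      rw [h4]
      rw [mul_add, h5] at h2
      linarith

end Estimator

end DataMHE

theorem theorem2 {n m p : ℕ}
    (A : Matrix (Fin n) (Fin n) ℝ) (B : Matrix (Fin n) (Fin m) ℝ)
    (C : Matrix (Fin p) (Fin n) ℝ) (D : Matrix (Fin p) (Fin m) ℝ)
    (P : Matrix (Fin n) (Fin n) ℝ) (R : Matrix (Fin p) (Fin p) ℝ) (ρ : ℝ)
    (X : Set (Fin n → ℝ)) (V : Set (Fin p → ℝ))
    (hctrb : DataMHE.Controllable A B) (hdet : DataMHE.Detectable A C)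
    (hP : P.PosDef) (hR : R.PosDef) (hρ : ρ ∈ Set.Ioo (0 : ℝ) 1) :
    -- detectability provides e-UOSS constants
    (∃ p₀ r₀ η : ℝ, DataMHE.IsEUOSS A B C D p₀ r₀ η) ∧
    -- and, whichever admissible ones are used, the estimator is RGES for long horizons
    ∀ p₀ r₀ η : ℝ, DataMHE.IsEUOSS A B C D p₀ r₀ η → η ≤ ρ →
      p₀ ≤ DataMHE.lambdaMin P → r₀ ≤ DataMHE.lambdaMin R →
      ∃ Lmin : ℕ, ∀ L : ℕ, 0 < L → Lmin ≤ L →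
        ∀ (N : ℕ) (ud : ℕ → Fin m → ℝ) (xd : ℕ → Fin n → ℝ) (yd : ℕ → Fin p → ℝ),
          DataMHE.IsOfflineTrajectory A B C D N ud xd yd →
          DataMHE.PersistentlyExciting N (L + n + 1) ud →
          -- the optimization problems have solutions if the constraint set is closed
          (IsClosed X → ∀ (x₀ xhat₀ : Fin n → ℝ) (u : ℕ → Fin m → ℝ) (v : ℕ → Fin p → ℝ),
            (∀ t, DataMHE.stateTraj A B x₀ u t ∈ X) →
            ∃ xhat : ℕ → Fin n → ℝ,
              (DataMHE.Scheme.mk N ud xd yd P R ρ X).IsEstimate L xhat₀ u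
                (DataMHE.noisyOutput A B C D x₀ u v) xhat) ∧
          DataMHE.IsRGES A B C D X V
            ((DataMHE.Scheme.mk N ud xd yd P R ρ X).IsEstimate L) := by
  refine ⟨hdet.exists_isEUOSS B D, fun p₀ r₀ η hss hη hp₀ hr₀ => ?_⟩
  obtain ⟨c, hc, hwin⟩ :=
    DataMHE.exists_window_error_le hctrb hP hR hρ hss hη hp₀ hr₀
  -- the final rate is `ρ ^ (1 / 4)`, as windows contract with rate `ρ ^ (1 / 2)`
  set lam := √√ρ with hlam
  have hlam0 : 0 < lam := Real.sqrt_pos.2 (Real.sqrt_pos.2 hρ.1)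
  have hlam1 : lam < 1 := by
    rw [hlam, Real.sqrt_lt' one_pos, Real.sqrt_lt' (by norm_num)]
    simpa using hρ.2
  have hlam2 : lam ^ 2 = √ρ := Real.sq_sqrt (Real.sqrt_nonneg ρ)
  obtain ⟨Lmin, hLmin⟩ := exists_pow_lt_of_lt_one (inv_pos.2 (one_pos.trans_le hc)) hlam1
  refine ⟨Lmin, fun L hL hLL N ud xd yd htraj hpe => ⟨fun hX x₀ xhat₀ u v hx => ?_, ?_⟩⟩
  · exact DataMHE.Scheme.exists_isEstimate (S := ⟨N, ud, xd, yd, P, R, ρ, X⟩) htraj hctrb hL hpe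
      hP (hss.1.trans hp₀) hρ.1 hX hx xhat₀ _
  · have hcL : c * lam ^ L ≤ 1 := by
      have h1 : lam ^ L ≤ c⁻¹ := (pow_le_pow_of_le_one hlam0.le hlam1.le hLL).trans hLmin.le
      calc c * lam ^ L ≤ c * c⁻¹ := by gcongr
        _ = 1 := mul_inv_cancel₀ (by positivity)
    refine ⟨c, c, lam, lam, hc, hc, ⟨hlam0, hlam1⟩, ⟨hlam0, hlam1⟩,
      fun x₀ xhat₀ u v _ hx xhat hest t => ?_⟩
    obtain ⟨h0, hest⟩ := DataMHE.Scheme.isEstimate_iff.1 hest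
    have hstep : ∀ t, 0 < t → DataMHE.vnorm (DataMHE.stateTraj A B x₀ u t - xhat t) ≤
        c * DataMHE.vnorm (DataMHE.stateTraj A B x₀ u (t - min L t) - xhat (t - min L t)) *
          (lam ^ 2) ^ min L t +
        ∑ τ ∈ Finset.Icc 1 (min L t), c * DataMHE.vnorm (v (t - τ)) * (lam ^ 2) ^ τ := by
      intro t ht
      obtain ⟨z, hz, hzt⟩ := hest t ht
      rw [hlam2, hzt]
      exact hwin ⟨N, ud, xd, yd, P, R, ρ, X⟩ rfl rfl rfl htraj L _ t (min_le_left _ _)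
        (min_le_right _ _) hpe x₀ u v hx _ z hz
    have key := DataMHE.error_le_of_window_error_le hL hc hlam0 hlam1.le hcL
      (e := fun t => DataMHE.vnorm (DataMHE.stateTraj A B x₀ u t - xhat t))
      (v := fun t => DataMHE.vnorm (v t)) (fun t => DataMHE.vnorm_nonneg _)
      (fun t => DataMHE.vnorm_nonneg _) hstep t
    rw [← h0]
    exact key
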